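/- Let the scalar field be $\mathbb{R}$ or $\mathbb{C}$. A Banach space $X$ is finitely representable in a Banach space $Y$ if for every $\varepsilon>0$ and every finite-dimensional subspace $A\subseteq X$ there are a subspace $B\subseteq Y$ and an isomorphism $u:A\to B$ with $\|u\|\,\|u^{-1}\|\le 1+\varepsilon$; $X^{f}$ denotes the class of all Banach spaces $Y$ such that each of $X$ and $Y$ is finitely representable in the other. A subspace $Y$ of a Banach space $Z$ is reflecting if for every $\varepsilon>0$ and every finite-dimensional subspace $A\subseteq Z$ there is an isomorphic embedding $u:A\to Y$ with $\|u\|\,\|u^{-1}\|\le 1+\varepsilon$ and $u(a)=a$ for all $a\in A\cap Y$. A Banach space $E$ is existentially closed in $X^{f}$ if $E\in X^{f}$ and, for every $Z\in X^{f}$ and every linear isometric embedding $i:E\to Z$, the image $iE$ is a reflecting subspace of $Z$; the class of all such $E$ is denoted by $\mathcal{E}(X^{f})$. The dimension $\dim(X)$ is the least cardinality of a subset of $X$ whose linear span is dense in $X$. **Theorem.** For every infinite-dimensional Banach space $X$ the class $\mathcal{E}(X^{f})$ of all Banach spaces existentially closed in $X^{f}$ is non-empty. Moreover, every $Y\in X^{f}$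 embeds linearly and isometrically into some $E\in\mathcal{E}(X^{f})$ with $\dim(E)=\dim(Y)$. -/

import Mathlib

universe u v w

/-- The dimension of a Banach space: the least cardinality of a subset whose linear span is
dense. -/
noncomputable def banachDim (𝕜 : Type v) (X : Type u) [RCLike 𝕜] [NormedAddCommGroup X]
    [NormedSpace 𝕜 X] : Cardinal.{u} :=
  sInf {c : Cardinal.{u} | ∃ A : Set X, Cardinal.mk A = c ∧
    Dense (Submodule.span 𝕜 A : Set X)}

/-- `X` is finitely representable in `Y`: for each `ε > 0`, every finite-dimensional subspace `A`
of `X` admits an isomorphism `u` onto a subspace `B` of `Y` with `‖u‖ ‖u⁻¹‖ ≤ 1 + ε`. -/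
def FinitelyRepresentable (𝕜 : Type v) (X : Type u) (Y : Type w) [RCLike 𝕜]
    [NormedAddCommGroup X] [NormedSpace 𝕜 X] [NormedAddCommGroup Y] [NormedSpace 𝕜 Y] : Prop :=
  ∀ ε : ℝ, 0 < ε → ∀ A : Submodule 𝕜 X, FiniteDimensional 𝕜 A →
    ∃ (B : Submodule 𝕜 Y) (u : A ≃L[𝕜] B),
      ‖(u : A →L[𝕜] B)‖ * ‖(u.symm : B →L[𝕜] A)‖ ≤ 1 + ε

/-- Finite equivalence. The class `X^f` consists of the Banach spaces `Y` with
`FinitelyEquivalent 𝕜 X Y`. -/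
def FinitelyEquivalent (𝕜 : Type v) (X : Type u) (Y : Type w) [RCLike 𝕜]
    [NormedAddCommGroup X] [NormedSpace 𝕜 X] [NormedAddCommGroup Y] [NormedSpace 𝕜 Y] : Prop :=
  FinitelyRepresentable 𝕜 X Y ∧ FinitelyRepresentable 𝕜 Y X

/-- `Y` is a reflecting subspace of `X`: for every `ε > 0` and every finite-dimensional subspace
`A` of `X` there is an isomorphic embedding `u` of `A` into `Y` (an isomorphism of `A` onto a
subspace `B` of `Y`) with `‖u‖ ‖u⁻¹‖ ≤ 1 + ε` which is the identity on `A ∩ Y`. -/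
def IsReflecting (𝕜 : Type v) {X : Type u} [RCLike 𝕜] [NormedAddCommGroup X] [NormedSpace 𝕜 X]
    (Y : Submodule 𝕜 X) : Prop :=
  ∀ ε : ℝ, 0 < ε → ∀ A : Submodule 𝕜 X, FiniteDimensional 𝕜 A →
    ∃ B : Submodule 𝕜 X, B ≤ Y ∧ ∃ u : A ≃L[𝕜] B,
      ‖(u : A →L[𝕜] B)‖ * ‖(u.symm : B →L[𝕜] A)‖ ≤ 1 + ε ∧
      ∀ a : A, (a : X) ∈ Y → (u a : X) = (a : X)

/-- `E` is existentially closed in the class `X^f`: it belongs to `X^f`, and its image under any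
isometric embedding into any Banach space `Z` of `X^f` is a reflecting subspace of `Z`.
(Without the membership in `X^f`, spaces which embed into no member of `X^f` would qualify
vacuously.) -/
def IsExistentiallyClosed (𝕜 : Type v) (X E : Type u) [RCLike 𝕜]
    [NormedAddCommGroup X] [NormedSpace 𝕜 X] [NormedAddCommGroup E] [NormedSpace 𝕜 E] : Prop :=
  FinitelyEquivalent 𝕜 X E ∧
    ∀ (Z : Type u) [NormedAddCommGroup Z] [NormedSpace 𝕜 Z] [CompleteSpace Z],
      FinitelyEquivalent 𝕜 X Z →
        ∀ i : E →ₗᵢ[𝕜] Z, IsReflecting 𝕜 (LinearMap.range i.toLinearMap)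

/-! Up to small distortion, a space `E` is existentially closed in `X^f` as soon as every finite
list of approximate norm conditions on unknown vectors, with parameters in `E`, that can be met in
some extension of `E` finitely representable in `X` can already be met in `E`. As in Henkin's
construction, each such list `p` is assigned a sequence of its own free generators, of higher rank
than all its parameters, as prospective solutions. One seminorm `N` on the resulting free space `W`
then has to satisfy every list that is satisfiable in some extension.

The seminorms on `W` that are finitely representable in `X`, at most `1` on the generators and
given in rank `0` by `Y`, form a compact set. Well-order the lists so that ranks do not decrease,
and choose `N` in this set lexicographically maximal with respect to the lists it satisfies. If `p`
could be satisfied in an extension `Z` of `(W, N)`, send the generators assigned to `p` to a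
solution in `Z` and leave the others in place. Every list before `p` has parameters of rank at most
that of `p` and other assigned generators, so it is unaffected, and the seminorm pulled back from
`Z` contradicts maximality unless `N` satisfies `p` already. The space `E` is the completion of
`(W, N)`. Coding scalars by a countable dense sequence keeps the number of lists, and hence the
dimension of `E`, down to that of `Y`. -/

open Set Filter Topology Cardinal

section AlmostIsometry

variable {𝕜 : Type*} [RCLike 𝕜] {A Z : Type*} [NormedAddCommGroup A] [NormedSpace 𝕜 A]
  [NormedAddCommGroup Z] [NormedSpace 𝕜 Z]

/-- A linear map is an `ε`-almost isometry if it changes the norm of each vector by at most `ε`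
times that norm. For `ε < 1` such maps are isomorphisms onto their range with distortion at most
`(1 + ε) / (1 - ε)`, so they replace the isomorphisms in the definitions above. -/
def IsAlmostIsometry (ε : ℝ) (T : A →ₗ[𝕜] Z) : Prop :=
  ∀ a, |‖T a‖ - ‖a‖| ≤ ε * ‖a‖

theorem isAlmostIsometry_of_sphere {ε : ℝ} {T : A →ₗ[𝕜] Z}
    (h : ∀ a, ‖a‖ = 1 → |‖T a‖ - 1| ≤ ε) : IsAlmostIsometry ε T := by
  intro a
  rcases eq_or_ne a 0 with rfl | ha
  · simp
  have hpos : 0 < ‖a‖ := norm_pos_iff.2 ha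
  have hunit := h _ (norm_smul_inv_norm (𝕜 := 𝕜) ha)
  rw [map_smul, norm_smul, norm_inv, RCLike.norm_ofReal, abs_norm] at hunit
  calc |‖T a‖ - ‖a‖| = |‖a‖⁻¹ * ‖T a‖ - 1| * ‖a‖ := by
        rw [← abs_of_pos hpos, ← abs_mul, abs_of_pos hpos]
        field_simp
    _ ≤ ε * ‖a‖ := by gcongr

theorem isAlmostIsometry_of_net {δ : ℝ} (hδ : δ ≤ 1 / 2) {F : Set A}
    (hF : F ⊆ Metric.sphere 0 1) (hcover : Metric.sphere 0 1 ⊆ ⋃ f ∈ F, Metric.ball f δ)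
    (T : A →L[𝕜] Z) (hT : ∀ f ∈ F, |‖T f‖ - ‖f‖| ≤ δ) :
    IsAlmostIsometry (4 * δ) (T : A →ₗ[𝕜] Z) := by
  have near_one : ∀ a, ‖a‖ = 1 → |‖T a‖ - 1| ≤ δ + ‖T‖ * δ ∧ 0 ≤ δ := by
    intro a ha
    obtain ⟨f, hf, haf⟩ := mem_iUnion₂.1 (hcover (mem_sphere_zero_iff_norm.2 ha))
    have haf' : ‖a - f‖ ≤ δ := (mem_ball_iff_norm.1 haf).le
    refine ⟨?_, (norm_nonneg _).trans haf'⟩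
    calc |‖T a‖ - 1| ≤ |‖T f‖ - ‖f‖| + |‖T a‖ - ‖T f‖| := by
          rw [mem_sphere_zero_iff_norm.1 (hF hf), add_comm]
          exact abs_sub_le _ _ _
      _ ≤ δ + ‖T (a - f)‖ := by
          rw [map_sub]
          exact add_le_add (hT f hf) (abs_norm_sub_norm_le _ _)
      _ ≤ δ + ‖T‖ * δ := by
          gcongr
          exact T.le_opNorm_of_le haf'
  -- The unknown norm of `T` enters its own bound with a coefficient `δ < 1`, so it can be absorbed.
  have norm_le : ‖T‖ ≤ 3 := by
    have : ‖T‖ ≤ max 0 (1 + δ + ‖T‖ * δ) :=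
      T.opNorm_le_of_unit_norm (le_max_left _ _) fun a ha =>
        le_max_of_le_right (by linarith [le_of_abs_le (near_one a ha).1])
    rcases le_max_iff.1 this with h | h <;> nlinarith [norm_nonneg T]
  refine isAlmostIsometry_of_sphere fun a ha => (near_one a ha).1.trans ?_
  nlinarith [(near_one a ha).2]

theorem mem_closure_pi_real_iff {α : Type*} {R : Set (α → ℝ)} {N : α → ℝ} :
    N ∈ closure R ↔ ∀ F : Set α, F.Finite → ∀ δ : ℝ, 0 < δ →
      ∃ M ∈ R, ∀ a ∈ F, |M a - N a| < δ := by
  have basis : (𝓝 N).HasBasis (fun I : Set α × (α → ℝ) => I.1.Finite ∧ ∀ a ∈ I.1, 0 < I.2 a)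
      fun I => I.1.pi fun a => Metric.ball (N a) (I.2 a) :=
    nhds_pi (a := N) ▸ hasBasis_pi fun a => Metric.nhds_basis_ball
  simp only [mem_closure_iff_nhds_basis basis, Set.mem_pi, Metric.mem_ball, Real.dist_eq]
  constructor
  · exact fun h F hF δ hδ => h (F, fun _ => δ) ⟨hF, fun _ _ => hδ⟩
  · rintro h ⟨F, r⟩ ⟨hF, hr⟩
    obtain ⟨δ, hδr, hδ⟩ := (((eventually_all_finite hF).2 fun a ha =>
      Iio_mem_nhds (hr a ha)).filter_mono nhdsWithin_le_nhds |>.and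
        (self_mem_nhdsWithin (s := Ioi 0))).exists
    obtain ⟨M, hM, hMN⟩ := h F hF δ hδ
    exact ⟨M, hM, fun a ha => (hMN a ha).trans (hδr a ha)⟩

theorem exists_isAlmostIsometry_of_norm_mem_closure [FiniteDimensional 𝕜 A]
    {𝒯 : Set (A →ₗ[𝕜] Z)} (h : norm ∈ closure ((fun T a => ‖T a‖) '' 𝒯)) {ε : ℝ} (hε : 0 < ε) :
    ∃ T ∈ 𝒯, IsAlmostIsometry ε T := by
  have : ProperSpace A := FiniteDimensional.proper_rclike 𝕜 A
  have hδ : 0 < min (1 / 2) (ε / 4) := by positivity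
  obtain ⟨F, hF, hFfin, hcover⟩ := (isCompact_sphere (0 : A) 1).finite_cover_balls hδ
  obtain ⟨_, ⟨T, hT, rfl⟩, hTF⟩ := mem_closure_pi_real_iff.1 h F hFfin _ hδ
  have key := isAlmostIsometry_of_net (min_le_left _ _) hF hcover T.toContinuousLinearMap
    fun f hf => (hTF f hf).le
  refine ⟨T, hT, fun a => (key a).trans ?_⟩
  gcongr
  linarith [min_le_right (1 / 2) (ε / 4)]

theorem IsAlmostIsometry.le_norm {ε : ℝ} {T : A →ₗ[𝕜] Z} (hT : IsAlmostIsometry ε T) (a : A) :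
    (1 - ε) * ‖a‖ ≤ ‖T a‖ := by
  linarith [neg_le_of_abs_le (hT a)]

theorem IsAlmostIsometry.norm_le {ε : ℝ} {T : A →ₗ[𝕜] Z} (hT : IsAlmostIsometry ε T) (a : A) :
    ‖T a‖ ≤ (1 + ε) * ‖a‖ := by
  linarith [le_of_abs_le (hT a)]

theorem IsAlmostIsometry.injective {ε : ℝ} (hε : ε < 1) {T : A →ₗ[𝕜] Z}
    (hT : IsAlmostIsometry ε T) : Function.Injective T := by
  refine (injective_iff_map_eq_zero T).2 fun a ha => norm_le_zero_iff.1 ?_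
  have := hT.le_norm a
  rw [ha, norm_zero] at this
  nlinarith

theorem IsAlmostIsometry.exists_equiv_range [FiniteDimensional 𝕜 A] {ε : ℝ} (hε₀ : 0 ≤ ε)
    (hε : ε < 1) {T : A →ₗ[𝕜] Z} (hT : IsAlmostIsometry ε T) :
    ∃ u : A ≃L[𝕜] LinearMap.range T,
      ‖(u : A →L[𝕜] LinearMap.range T)‖ * ‖(u.symm : LinearMap.range T →L[𝕜] A)‖ ≤
        (1 + ε) / (1 - ε) ∧ ∀ a, (u a : Z) = T a := by
  have hpos : 0 < 1 - ε := sub_pos.2 hε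
  let u := (LinearEquiv.ofInjective T (hT.injective hε)).toContinuousLinearEquiv
  have hu : ∀ a, (u a : Z) = T a := fun a => rfl
  have norm_u : ∀ a, ‖u a‖ = ‖T a‖ := fun a => by rw [← hu, Submodule.coe_norm]
  refine ⟨u, ?_, hu⟩
  rw [div_eq_mul_inv]
  refine mul_le_mul ?_ ?_ (norm_nonneg _) (by positivity)
  · refine ContinuousLinearMap.opNorm_le_bound _ (by positivity) fun a => ?_
    simpa only [ContinuousLinearEquiv.coe_coe, norm_u] using hT.norm_le a
  · refine ContinuousLinearMap.opNorm_le_bound _ (by positivity) fun y => ?_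
    obtain ⟨a, rfl⟩ := u.surjective y
    rw [ContinuousLinearEquiv.coe_coe, u.symm_apply_apply, norm_u, le_inv_mul_iff₀ hpos]
    exact hT.le_norm a

theorem exists_one_add_div_one_sub_le {ε : ℝ} (hε : 0 < ε) :
    ∃ η : ℝ, 0 < η ∧ η < 1 ∧ (1 + η) / (1 - η) ≤ 1 + ε := by
  refine ⟨ε / (2 + ε), by positivity, by rw [div_lt_one] <;> linarith, le_of_eq ?_⟩
  have : 1 - ε / (2 + ε) ≠ 0 := by
    rw [one_sub_div (by positivity), add_sub_cancel_right]
    positivity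
  field_simp
  ring

end AlmostIsometry

section FiniteRepresentability

/-- The functions on a vector space `W` which are pointwise limits of functions `‖T ·‖` with
`T : W → X` linear. They are the seminorms on `W` that are finitely representable in `X`. -/
def representableSeminorms (𝕜 W X : Type*) [RCLike 𝕜] [AddCommGroup W] [Module 𝕜 W]
    [NormedAddCommGroup X] [NormedSpace 𝕜 X] : Set (W → ℝ) :=
  closure (range fun (T : W →ₗ[𝕜] X) w => ‖T w‖)

variable {𝕜 : Type v} [RCLike 𝕜] {X : Type u} {Y : Type w} {V W Z : Type*}
  [NormedAddCommGroup X] [NormedSpace 𝕜 X] [NormedAddCommGroup Y] [NormedSpace 𝕜 Y]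
  [NormedAddCommGroup Z] [NormedSpace 𝕜 Z] [AddCommGroup V] [Module 𝕜 V]
  [AddCommGroup W] [Module 𝕜 W]

theorem norm_comp_mem_representableSeminorms (T : W →ₗ[𝕜] X) :
    (fun w => ‖T w‖) ∈ representableSeminorms 𝕜 W X :=
  subset_closure (mem_range_self T)

theorem comp_mem_representableSeminorms (φ : V →ₗ[𝕜] W) {N : W → ℝ}
    (hN : N ∈ representableSeminorms 𝕜 W X) : N ∘ φ ∈ representableSeminorms 𝕜 V X :=
  map_mem_closure (f := (· ∘ φ)) (by fun_prop) hN <| forall_mem_range.2 fun T => ⟨T ∘ₗ φ, rfl⟩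

theorem finitelyRepresentable_of_forall_finiteDimensional
    (h : ∀ A : Submodule 𝕜 X, FiniteDimensional 𝕜 A → norm ∈ representableSeminorms 𝕜 A Y) :
    FinitelyRepresentable 𝕜 X Y := by
  intro ε hε A hA
  obtain ⟨η, hη₀, hη₁, hηε⟩ := exists_one_add_div_one_sub_le hε
  obtain ⟨T, -, hT⟩ := exists_isAlmostIsometry_of_norm_mem_closure (𝒯 := univ)
    (by rw [image_univ]; exact h A hA) hη₀
  obtain ⟨u, hu, -⟩ := hT.exists_equiv_range hη₀.le hη₁
  exact ⟨_, u, hu.trans hηε⟩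

theorem FinitelyRepresentable.exists_isAlmostIsometry (h : FinitelyRepresentable 𝕜 X Y)
    (A : Submodule 𝕜 X) [FiniteDimensional 𝕜 A] {ε : ℝ} (hε : 0 < ε) :
    ∃ T : A →ₗ[𝕜] Y, IsAlmostIsometry ε T := by
  obtain ⟨B, u, hu⟩ := h ε hε A inferInstance
  set c := ‖(u.symm : B →L[𝕜] A)‖
  refine ⟨(c : 𝕜) • (B.subtype ∘ₗ u.toLinearEquiv.toLinearMap), fun a => ?_⟩
  have norm_eq : ‖((c : 𝕜) • (B.subtype ∘ₗ u.toLinearEquiv.toLinearMap)) a‖ = c * ‖u a‖ := by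
    simp [norm_smul, c]
  have lower : ‖a‖ ≤ c * ‖u a‖ := by
    simpa using (u.symm : B →L[𝕜] A).le_opNorm (u a)
  have upper : c * ‖u a‖ ≤ (1 + ε) * ‖a‖ := calc
    c * ‖u a‖ ≤ c * (‖(u : A →L[𝕜] B)‖ * ‖a‖) := by
      gcongr
      exact (u : A →L[𝕜] B).le_opNorm a
    _ ≤ (1 + ε) * ‖a‖ := by
      rw [← mul_assoc, mul_comm c]
      gcongr
  rw [norm_eq, abs_of_nonneg (sub_nonneg.2 lower)]
  linarith

theorem finitelyRepresentable_iff_norm_mem :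
    FinitelyRepresentable 𝕜 X Y ↔ norm ∈ representableSeminorms 𝕜 X Y := by
  refine ⟨fun h => ?_, fun h => finitelyRepresentable_of_forall_finiteDimensional
    fun A _ => comp_mem_representableSeminorms A.subtype h⟩
  refine mem_closure_pi_real_iff.2 fun F hF δ hδ => ?_
  obtain ⟨ε, hεδ, hε⟩ : ∃ ε : ℝ, (∀ f ∈ F, ε * ‖f‖ < δ) ∧ 0 < ε := by
    have small : ∀ᶠ ε : ℝ in 𝓝 0, ∀ f ∈ F, ε * ‖f‖ < δ :=
      (eventually_all_finite hF).2 fun f _ => (continuous_mul_const ‖f‖).tendsto' 0 0 (zero_mul _)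
        |>.eventually_lt_const hδ
    exact ((small.filter_mono nhdsWithin_le_nhds).and (self_mem_nhdsWithin (s := Ioi 0))).exists
  have : FiniteDimensional 𝕜 (Submodule.span 𝕜 F) := FiniteDimensional.span_of_finite 𝕜 hF
  obtain ⟨T, hT⟩ := h.exists_isAlmostIsometry (Submodule.span 𝕜 F) hε
  obtain ⟨S, hS⟩ := LinearMap.exists_extend T
  refine ⟨_, ⟨S, rfl⟩, fun f hf => ?_⟩
  have hSf : S f = T ⟨f, Submodule.subset_span hf⟩ :=
    LinearMap.congr_fun hS ⟨f, Submodule.subset_span hf⟩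
  simp only [hSf]
  exact (hT _).trans_lt (hεδ f hf)

theorem FinitelyRepresentable.representableSeminorms_subset (h : FinitelyRepresentable 𝕜 Z X) :
    representableSeminorms 𝕜 W Z ⊆ representableSeminorms 𝕜 W X :=
  closure_minimal (range_subset_iff.2 fun T =>
    comp_mem_representableSeminorms T (finitelyRepresentable_iff_norm_mem.1 h)) isClosed_closure

theorem FinitelyRepresentable.trans (hXY : FinitelyRepresentable 𝕜 X Y)
    (hYZ : FinitelyRepresentable 𝕜 Y Z) : FinitelyRepresentable 𝕜 X Z :=
  finitelyRepresentable_iff_norm_mem.2 <|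
    hYZ.representableSeminorms_subset (finitelyRepresentable_iff_norm_mem.1 hXY)

theorem FinitelyRepresentable.of_isometry (j : X →ₗᵢ[𝕜] Y) : FinitelyRepresentable 𝕜 X Y :=
  finitelyRepresentable_iff_norm_mem.2 <| by
    simpa using norm_comp_mem_representableSeminorms j.toLinearMap

theorem FinitelyEquivalent.refl (X : Type u) [NormedAddCommGroup X] [NormedSpace 𝕜 X] :
    FinitelyEquivalent 𝕜 X X :=
  ⟨.of_isometry .id, .of_isometry .id⟩

theorem mem_closure_range_comp_of_denseRange {φ : W →ₗ[𝕜] X} (hφ : DenseRange φ)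
    [FiniteDimensional 𝕜 V] (S : V →ₗ[𝕜] X) :
    ⇑S ∈ closure (range fun T : V →ₗ[𝕜] W => ⇑(φ ∘ₗ T)) := by
  let b := Module.finBasis 𝕜 V
  let extend : (Fin (Module.finrank 𝕜 V) → X) → V → X := fun x a => ∑ i, b.repr a i • x i
  have extend_mem : ∀ w : Fin (Module.finrank 𝕜 V) → W,
      extend (Pi.map (fun _ => φ) w) ∈ range fun T : V →ₗ[𝕜] W => ⇑(φ ∘ₗ T) := fun w =>
    ⟨b.constr 𝕜 w, by ext a; simp [extend, Module.Basis.constr_apply_fintype]⟩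
  have extend_basis : extend (S ∘ b) = S := by
    ext a
    simp only [extend, Function.comp_apply, ← map_smul, ← map_sum, b.sum_repr]
  rw [← extend_basis]
  refine map_mem_closure (f := extend) (by fun_prop) (DenseRange.piMap (fun _ => hφ) _)
    (forall_mem_range.2 extend_mem)

theorem finitelyRepresentable_of_denseRange {φ : W →ₗ[𝕜] X} (hφ : DenseRange φ)
    (h : (fun w => ‖φ w‖) ∈ representableSeminorms 𝕜 W Y) : FinitelyRepresentable 𝕜 X Y := by
  refine finitelyRepresentable_of_forall_finiteDimensional fun A _ => ?_
  have approx := map_mem_closure (f := fun (S : A → X) a => ‖S a‖) (by fun_prop)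
    (mem_closure_range_comp_of_denseRange hφ A.subtype)
    (forall_mem_range.2 fun T => comp_mem_representableSeminorms T h)
  rwa [representableSeminorms, closure_closure] at approx

theorem FinitelyRepresentable.not_finiteDimensional (h : FinitelyRepresentable 𝕜 X Y)
    (hX : ¬ FiniteDimensional 𝕜 X) : ¬ FiniteDimensional 𝕜 Y := by
  intro hY
  have hrank : ((Module.finrank 𝕜 Y + 1 : ℕ) : Cardinal) ≤ Module.rank 𝕜 X :=
    Cardinal.natCast_lt_aleph0.le.trans (not_lt.1 fun hlt => hX (Module.rank_lt_aleph0_iff.1 hlt))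
  obtain ⟨x, hx⟩ := Module.le_rank_iff.1 hrank
  obtain ⟨B, u, -⟩ := h 1 one_pos (Submodule.span 𝕜 (range x))
    (FiniteDimensional.span_of_finite 𝕜 (finite_range x))
  have hcard := finrank_span_eq_card hx
  have hB := B.finrank_le
  rw [Fintype.card_fin, u.toLinearEquiv.finrank_eq] at hcard
  omega

theorem isReflecting_of_forall_finiteDimensional {Y : Submodule 𝕜 X}
    (h : ∀ A : Submodule 𝕜 X, FiniteDimensional 𝕜 A → norm ∈ closure ((fun T a => ‖T a‖) ''
      {T : A →ₗ[𝕜] X | (∀ a, T a ∈ Y) ∧ ∀ a : A, (a : X) ∈ Y → T a = a})) :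
    IsReflecting 𝕜 Y := by
  intro ε hε A hA
  obtain ⟨η, hη₀, hη₁, hηε⟩ := exists_one_add_div_one_sub_le hε
  obtain ⟨T, ⟨hTY, hTA⟩, hT⟩ := exists_isAlmostIsometry_of_norm_mem_closure (h A hA) hη₀
  obtain ⟨u, hu, huT⟩ := hT.exists_equiv_range hη₀.le hη₁
  refine ⟨_, LinearMap.range_le_iff_comap.2 (eq_top_iff.2 fun a _ => hTY a), u, hu.trans hηε,
    fun a ha => (huT a).trans (hTA a ha)⟩

end FiniteRepresentability

section LexicographicMaximality

theorem exists_linearOrder_wellFoundedLT_monotone {α β : Type*} [LinearOrder β] [WellFoundedLT β]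
    (f : α → β) : ∃ _ : LinearOrder α, WellFoundedLT α ∧ Monotone f := by
  obtain ⟨_, _⟩ := exists_wellFoundedLT α
  let e : α → β ×ₗ α := fun a => toLex (f a, a)
  refine ⟨LinearOrder.lift' e fun a a' h => congrArg (fun x => (ofLex x).2) h,
    ⟨InvImage.wf e wellFounded_lt⟩, fun a a' h => ?_⟩
  exact Prod.Lex.monotone_fst _ _ h

theorem exists_lexMaximal {α P : Type*} [TopologicalSpace α] [LinearOrder P] [WellFoundedLT P]
    {C : Set α} (hC : IsCompact C) (hne : C.Nonempty) {R : P → Set α} (hR : ∀ p, IsClosed (R p)) :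
    ∃ x ∈ C, ∀ p, ∀ y ∈ C, (∀ q < p, x ∈ R q → y ∈ R q) → y ∈ R p → x ∈ R p := by
  -- `p` is accepted if some point of `C` lies in `R p` and in `R q` for all accepted `q < p`.
  let Accepted : P → Prop := wellFounded_lt.fix fun p accepted =>
    ∃ y ∈ C, (∀ q, ∀ h : q < p, accepted q h → y ∈ R q) ∧ y ∈ R p
  have accepted_iff : ∀ p, Accepted p ↔ ∃ y ∈ C, (∀ q < p, Accepted q → y ∈ R q) ∧ y ∈ R p :=
    fun p => iff_of_eq (wellFounded_lt.fix_eq _ p)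
  obtain ⟨x, hxC, hx⟩ : (C ∩ ⋂ p : {p // Accepted p}, R p).Nonempty := by
    refine hC.inter_iInter_nonempty _ (fun p => hR p) fun F => ?_
    rcases F.eq_empty_or_nonempty with rfl | hF
    · simpa using hne
    obtain ⟨y, hyC, hy, hym⟩ := (accepted_iff _).1 (F.max' hF).2
    refine ⟨y, hyC, mem_iInter₂.2 fun p hp => ?_⟩
    rcases (F.le_max' p hp).eq_or_lt with h | h
    · exact h ▸ hym
    · exact hy p h p.2
  have mem_of_accepted : ∀ p, Accepted p → x ∈ R p := fun p hp => mem_iInter.1 hx ⟨p, hp⟩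
  exact ⟨x, hxC, fun p y hyC hy hyp => mem_of_accepted p <| (accepted_iff p).2
    ⟨y, hyC, fun q hq hqA => hy q hq (mem_of_accepted q hqA), hyp⟩⟩

end LexicographicMaximality

section RepresentableSeminorms

variable {𝕜 W X : Type*} [RCLike 𝕜] [AddCommGroup W] [Module 𝕜 W] [NormedAddCommGroup X]
  [NormedSpace 𝕜 X]

theorem exists_seminorm_coe_eq {N : W → ℝ} (hN : N ∈ representableSeminorms 𝕜 W X) :
    ∃ p : Seminorm 𝕜 W, ⇑p = N := by
  have add_le : ∀ x y, N (x + y) ≤ N x + N y := fun x y =>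
    closure_minimal (t := {N : W → ℝ | N (x + y) ≤ N x + N y})
      (range_subset_iff.2 fun T => by simpa using norm_add_le (T x) (T y))
      (isClosed_le (by fun_prop) (by fun_prop)) hN
  have smul : ∀ (c : 𝕜) x, N (c • x) = ‖c‖ * N x := fun c x =>
    closure_minimal (t := {N : W → ℝ | N (c • x) = ‖c‖ * N x})
      (range_subset_iff.2 fun T => by simp [norm_smul])
      (isClosed_eq (by fun_prop) (by fun_prop)) hN
  exact ⟨Seminorm.of N add_le smul, rfl⟩

theorem isCompact_representableSeminorms_le_one {ι : Type*} {b : ι → W}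
    (hb : Submodule.span 𝕜 (range b) = ⊤) :
    IsCompact {N ∈ representableSeminorms 𝕜 W X | ∀ i, N (b i) ≤ 1} := by
  have bound : ∀ w, ∃ M : ℝ, ∀ p : Seminorm 𝕜 W, (∀ i, p (b i) ≤ 1) → p w ≤ M := by
    intro w
    obtain ⟨c, rfl⟩ := Finsupp.mem_span_range_iff_exists_finsupp.1 (hb ▸ Submodule.mem_top (x := w))
    refine ⟨∑ i ∈ c.support, ‖c i‖, fun p hp => ?_⟩
    calc p (c.sum fun i a => a • b i) ≤ ∑ i ∈ c.support, p (c i • b i) :=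
          Finset.le_sum_of_subadditive p (map_zero p).le (map_add_le_add p) _ _
      _ ≤ ∑ i ∈ c.support, ‖c i‖ := by
          gcongr with i
          rw [map_smul_eq_mul]
          exact mul_le_of_le_one_right (norm_nonneg _) (hp i)
  choose M hM using bound
  refine (isCompact_univ_pi fun w => isCompact_Icc (a := 0) (b := M w)).of_isClosed_subset ?_ ?_
  · simp only [ofPred_and, ofPred_forall]
    exact isClosed_closure.inter
      (isClosed_iInter fun i => isClosed_le (continuous_apply _) continuous_const)
  · rintro _ ⟨hN, hb⟩ w -
    obtain ⟨p, rfl⟩ := exists_seminorm_coe_eq hN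
    exact ⟨apply_nonneg p w, hM w p hb⟩

end RepresentableSeminorms

section NormProblems

/-- The linear combination of a family `v` described by a list of indices and codes of scalars,
where a natural number codes a term of a fixed dense sequence. Unlike arbitrary linear combinations,
those of a family indexed by an infinite `T` have only `#T` descriptions. -/
noncomputable def codedSum (𝕜 : Type*) [RCLike 𝕜] {T M : Type*} [AddCommGroup M] [Module 𝕜 M]
    (v : T → M) (l : List (T × ℕ)) : M :=
  (l.map fun x => TopologicalSpace.denseSeq 𝕜 x.2 • v x.1).sum

/-- A norm problem in the variables `T`: a list of entries `(l, q, r)`, each prescribing the norm of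
the linear combination coded by `l` up to an error `r` from `q`. -/
abbrev NormProblem (T : Type*) : Type _ := List (List (T × ℕ) × ℚ × ℚ)

namespace NormProblem

/-- The assignment `v` solves the problem `p`, norms being measured by `N`. -/
def Solves (𝕜 : Type*) [RCLike 𝕜] {T M : Type*} [AddCommGroup M] [Module 𝕜 M] (p : NormProblem T)
    (N : M → ℝ) (v : T → M) : Prop :=
  ∀ k ∈ p, |N (codedSum 𝕜 v k.1) - k.2.1| ≤ k.2.2

/-- The variables occurring in a problem. -/
def vars {T : Type*} (p : NormProblem T) : List T :=
  p.flatMap fun k => k.1.map Prod.fst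

/-- The rank of a problem whose parameters, the variables in `G`, carry ranks `ρ`; the unknowns, the
variables in `ℕ`, are not counted. Any upper bound of the ranks of the parameters would do. -/
def rank {G : Type*} (ρ : G → ℕ) (p : NormProblem (G ⊕ ℕ)) : ℕ :=
  (p.vars.map (Sum.elim ρ fun _ => 0)).sum

/-- The assignment that evaluates the parameters of `p` by the family `b` and its unknowns by the
members of `b` with the indices `σ (p, j)` reserved for them. -/
def assignment {G M : Type*} (b : G → M) (σ : NormProblem (G ⊕ ℕ) × ℕ → G)
    (p : NormProblem (G ⊕ ℕ)) : G ⊕ ℕ → M :=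
  Sum.elim b fun j => b (σ (p, j))

end NormProblem

variable {𝕜 : Type*} [RCLike 𝕜] {T M M' : Type*} [AddCommGroup M] [Module 𝕜 M]
  [AddCommGroup M'] [Module 𝕜 M']

theorem map_codedSum (f : M →ₗ[𝕜] M') (v : T → M) (l : List (T × ℕ)) :
    f (codedSum 𝕜 v l) = codedSum 𝕜 (f ∘ v) l := by
  simp [codedSum, map_list_sum, Function.comp_def]

theorem codedSum_congr {v v' : T → M} {l : List (T × ℕ)} (h : ∀ x ∈ l, v x.1 = v' x.1) :
    codedSum 𝕜 v l = codedSum 𝕜 v' l :=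
  congrArg List.sum <| List.map_congr_left fun x hx => by rw [h x hx]

namespace NormProblem

theorem solves_iff_of_forall_mem_vars {p : NormProblem T} {N : M → ℝ} {N' : M' → ℝ} {v : T → M}
    {v' : T → M'} (f : M →ₗ[𝕜] M') (hf : ∀ x, N' (f x) = N x) (hv : ∀ t ∈ p.vars, f (v t) = v' t) :
    p.Solves 𝕜 N v ↔ p.Solves 𝕜 N' v' := by
  refine forall₂_congr fun k hk => ?_
  have : f (codedSum 𝕜 v k.1) = codedSum 𝕜 v' k.1 := (map_codedSum f v k.1).trans <|
    codedSum_congr fun x hx => hv _ (List.mem_flatMap.2 ⟨k, hk, List.mem_map_of_mem hx⟩)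
  rw [← this, hf]

theorem isClosed_setOf_solves (p : NormProblem T) (v : T → M) :
    IsClosed {N : M → ℝ | p.Solves 𝕜 N v} := by
  simp only [Solves, ofPred_forall]
  exact isClosed_iInter fun k => isClosed_iInter fun _ =>
    isClosed_le (by fun_prop) continuous_const

theorem le_rank {G : Type*} (ρ : G → ℕ) {p : NormProblem (G ⊕ ℕ)} {g : G}
    (hg : Sum.inl g ∈ p.vars) : ρ g ≤ p.rank ρ :=
  List.le_sum_of_mem (List.mem_map.2 ⟨_, hg, rfl⟩)

theorem exists_witness_indexing (I : Type u) [Infinite I] :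
    ∃ σ : NormProblem ((I × ℕ) ⊕ ℕ) × ℕ → I × ℕ, Function.Injective σ ∧
      ∀ p j, p.rank Prod.snd < (σ (p, j)).2 := by
  have mk_eq : #(NormProblem ((I × ℕ) ⊕ ℕ) × ℕ) = #I := by
    simp [NormProblem, Cardinal.mk_list_eq_mk, Cardinal.add_eq_left]
  obtain ⟨e⟩ := Cardinal.eq.1 mk_eq
  refine ⟨fun x => (e x, x.1.rank Prod.snd + 1), fun x y h => e.injective (congrArg Prod.fst h),
    fun _ _ => Nat.lt_succ_self _⟩

end NormProblem

end NormProblems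

section Saturation

variable {𝕜 : Type*} [RCLike 𝕜] {G W X : Type*} [AddCommGroup W] [Module 𝕜 W]
  [NormedAddCommGroup X] [NormedSpace 𝕜 X]

theorem exists_linearMap_of_injective {ι Z : Type*} [AddCommGroup Z] [Module 𝕜 Z]
    (b : Module.Basis G 𝕜 W) {s : ι → G} (hs : Function.Injective s) (z : ι → Z) (f : W →ₗ[𝕜] Z) :
    ∃ T : W →ₗ[𝕜] Z, (∀ j, T (b (s j)) = z j) ∧ ∀ g ∉ range s, T (b g) = f (b g) :=
  ⟨b.constr 𝕜 (Function.extend s z (f ∘ b)),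
    fun j => by rw [b.constr_basis, hs.extend_apply],
    fun g hg => by rw [b.constr_basis, Function.extend_apply' _ _ _ hg, Function.comp_apply]⟩

theorem exists_linearMap_solves {Z : Type*} [NormedAddCommGroup Z] [NormedSpace 𝕜 Z]
    (b : Module.Basis G 𝕜 W) {ρ : G → ℕ} {σ : NormProblem (G ⊕ ℕ) × ℕ → G}
    (hσ : Function.Injective σ) (hρ : ∀ p j, p.rank ρ < ρ (σ (p, j))) (i : W →ₗ[𝕜] Z)
    {p : NormProblem (G ⊕ ℕ)} {z : ℕ → Z} (hp : p.Solves 𝕜 norm (Sum.elim (i ∘ b) z)) :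
    ∃ T : W →ₗ[𝕜] Z, (∀ g, T (b g) = i (b g) ∨ T (b g) ∈ range z) ∧
      (∀ g, ρ g ≤ p.rank ρ → T (b g) = i (b g)) ∧
      p.Solves 𝕜 (fun w => ‖T w‖) (p.assignment b σ) ∧
      ∀ q ≠ p, q.rank ρ ≤ p.rank ρ → q.Solves 𝕜 (fun w => ‖i w‖) (q.assignment b σ) →
        q.Solves 𝕜 (fun w => ‖T w‖) (q.assignment b σ) := by
  obtain ⟨T, T_witness, T_eq⟩ :=
    exists_linearMap_of_injective b (hσ.comp (Prod.mk_right_injective p)) z i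
  have T_low : ∀ g, ρ g ≤ p.rank ρ → T (b g) = i (b g) := fun g hg => T_eq g <| by
    rintro ⟨j, rfl⟩
    exact (hρ p j).not_ge hg
  refine ⟨T, fun g => ?_, T_low, ?_, fun q hqp hrank hq => ?_⟩
  · by_cases hg : g ∈ range (σ ∘ Prod.mk p)
    · obtain ⟨j, rfl⟩ := hg
      exact .inr ⟨j, (T_witness j).symm⟩
    · exact .inl (T_eq g hg)
  · refine (NormProblem.solves_iff_of_forall_mem_vars T (fun _ => rfl) ?_).2 hp
    rintro (g | j) ht
    · exact T_low g (NormProblem.le_rank ρ ht)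
    · exact T_witness j
  · rw [NormProblem.solves_iff_of_forall_mem_vars (N' := norm) i (fun _ => rfl) fun _ _ => rfl]
      at hq
    refine (NormProblem.solves_iff_of_forall_mem_vars T (fun _ => rfl) ?_).2 hq
    rintro (g | j) ht
    · exact T_low g ((NormProblem.le_rank ρ ht).trans hrank)
    · refine T_eq _ ?_
      rintro ⟨j', h⟩
      exact hqp (congrArg Prod.fst (hσ h)).symm

theorem exists_saturated_seminorm (b : Module.Basis G 𝕜 W) {ρ : G → ℕ}
    {σ : NormProblem (G ⊕ ℕ) × ℕ → G} (hσ : Function.Injective σ)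
    (hρ : ∀ p j, p.rank ρ < ρ (σ (p, j))) {N₀ : W → ℝ} (hN₀ : N₀ ∈ representableSeminorms 𝕜 W X)
    (hN₀b : ∀ g, N₀ (b g) ≤ 1) :
    ∃ N ∈ representableSeminorms 𝕜 W X, (∀ g, N (b g) ≤ 1) ∧
      (∀ w ∈ Submodule.span 𝕜 (b '' {g | ρ g = 0}), N w = N₀ w) ∧
      ∀ (Z : Type w) [NormedAddCommGroup Z] [NormedSpace 𝕜 Z], FinitelyRepresentable 𝕜 Z X →
        ∀ i : W →ₗ[𝕜] Z, (∀ w, ‖i w‖ = N w) →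
          ∀ (p : NormProblem (G ⊕ ℕ)) (z : ℕ → Z), (∀ j, ‖z j‖ ≤ 1) →
            p.Solves 𝕜 norm (Sum.elim (i ∘ b) z) → p.Solves 𝕜 N (p.assignment b σ) := by
  obtain ⟨_, _, rank_mono⟩ :=
    exists_linearOrder_wellFoundedLT_monotone fun p : NormProblem (G ⊕ ℕ) => p.rank ρ
  have agree_closed : IsClosed {N : W → ℝ | ∀ w ∈ Submodule.span 𝕜 (b '' {g | ρ g = 0}),
      N w = N₀ w} := by
    simp only [ofPred_forall]
    exact isClosed_iInter fun w => isClosed_iInter fun _ =>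
      isClosed_eq (continuous_apply _) continuous_const
  obtain ⟨N, ⟨⟨hN, hNb⟩, hNN₀⟩, hmax⟩ := exists_lexMaximal
    ((isCompact_representableSeminorms_le_one b.span_eq).inter_right agree_closed)
    ⟨N₀, ⟨hN₀, hN₀b⟩, fun _ _ => rfl⟩
    fun p : NormProblem (G ⊕ ℕ) => p.isClosed_setOf_solves (𝕜 := 𝕜) (p.assignment b σ)
  refine ⟨N, hN, hNb, hNN₀, fun Z _ _ hZ i hi p z hz hp => ?_⟩
  obtain rfl : (fun w => ‖i w‖) = N := funext hi
  obtain ⟨T, T_basis, T_low, T_solves, T_preserves⟩ := exists_linearMap_solves b hσ hρ i hp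
  refine hmax p (fun w => ‖T w‖) ⟨⟨?_, fun g => ?_⟩, fun w hw => ?_⟩
    (fun q hqp => T_preserves q hqp.ne (rank_mono hqp.le)) T_solves
  · exact hZ.representableSeminorms_subset (norm_comp_mem_representableSeminorms T)
  · rcases T_basis g with h | ⟨j, h⟩
    · exact (congrArg norm h).trans_le (hNb g)
    · exact (congrArg norm h).symm.trans_le (hz j)
  · have : EqOn T i (Submodule.span 𝕜 (b '' {g | ρ g = 0})) :=
      LinearMap.eqOn_span <| forall_mem_image.2 fun g hg => T_low g (hg.le.trans (Nat.zero_le _))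
    exact (congrArg norm (this hw)).trans (hNN₀ w hw)

end Saturation

section Reflecting

variable {𝕜 Z : Type*} [RCLike 𝕜] [NormedAddCommGroup Z] [NormedSpace 𝕜 Z]

theorem exists_codedSum_near {T : Type*} (w : T →₀ 𝕜) {δ : ℝ} (hδ : 0 < δ) :
    ∃ l : List (T × ℕ), ∀ v : T → Z, (∀ t, ‖v t‖ ≤ 1) →
      ‖Finsupp.linearCombination 𝕜 v w - codedSum 𝕜 v l‖ ≤ δ := by
  induction w using Finsupp.induction_linear generalizing δ with
  | zero => exact ⟨[], fun v _ => by simpa [codedSum] using hδ.le⟩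
  | add x y hx hy =>
    obtain ⟨l, hl⟩ := hx (half_pos hδ)
    obtain ⟨l', hl'⟩ := hy (half_pos hδ)
    refine ⟨l ++ l', fun v hv => ?_⟩
    have codedSum_append : codedSum 𝕜 v (l ++ l') = codedSum 𝕜 v l + codedSum 𝕜 v l' := by
      simp [codedSum]
    rw [codedSum_append, map_add, add_sub_add_comm]
    exact (norm_add_le_of_le (hl v hv) (hl' v hv)).trans (add_halves δ).le
  | single t a =>
    obtain ⟨n, hn⟩ := (TopologicalSpace.denseRange_denseSeq 𝕜).exists_dist_lt a hδ
    refine ⟨[(t, n)], fun v hv => ?_⟩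
    have codedSum_singleton : codedSum 𝕜 v [(t, n)] = TopologicalSpace.denseSeq 𝕜 n • v t := by
      simp [codedSum]
    rw [codedSum_singleton, Finsupp.linearCombination_single, ← sub_smul, norm_smul,
      ← dist_eq_norm]
    exact (mul_le_of_le_one_right dist_nonneg (hv t)).trans hn.le

theorem exists_codedSum_sumElim_near {G : Type*} {c : G → Z} (hc : ∀ g, ‖c g‖ ≤ 1) {e : Z}
    (he : e ∈ closure (Submodule.span 𝕜 (range c) : Set Z)) (d : ℕ →₀ 𝕜) {δ : ℝ} (hδ : 0 < δ) :
    ∃ l : List ((G ⊕ ℕ) × ℕ), ∀ y : ℕ → Z, (∀ j, ‖y j‖ ≤ 1) →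
      ‖e + Finsupp.linearCombination 𝕜 y d - codedSum 𝕜 (Sum.elim c y) l‖ ≤ δ := by
  obtain ⟨_, hspan, hdist⟩ := Metric.mem_closure_iff.1 he _ (half_pos hδ)
  obtain ⟨w, rfl⟩ := (Finsupp.mem_span_range_iff_exists_finsupp).1 hspan
  obtain ⟨l, hl⟩ := exists_codedSum_near (Z := Z) (w.mapDomain Sum.inl + d.mapDomain Sum.inr)
    (half_pos hδ)
  refine ⟨l, fun y hy => ?_⟩
  have combination : Finsupp.linearCombination 𝕜 (Sum.elim c y)
      (w.mapDomain Sum.inl + d.mapDomain Sum.inr) =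
        (w.sum fun g a => a • c g) + Finsupp.linearCombination 𝕜 y d := by
    rw [map_add, Finsupp.linearCombination_mapDomain, Finsupp.linearCombination_mapDomain,
      Sum.elim_comp_inl, Sum.elim_comp_inr, Finsupp.linearCombination_apply]
  have near := hl (Sum.elim c y) (Sum.forall.2 ⟨hc, hy⟩)
  rw [combination] at near
  rw [dist_eq_norm] at hdist
  refine (norm_add_le_of_le hdist.le near).trans' (le_of_eq ?_) |>.trans (add_halves δ).le
  congr 1
  abel

theorem exists_normProblem_forall_solution {G : Type*} {c : G → Z} (hc : ∀ g, ‖c g‖ ≤ 1)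
    {F : Set (Z × (ℕ →₀ 𝕜))} (hF : F.Finite)
    (hFc : ∀ x ∈ F, x.1 ∈ closure (Submodule.span 𝕜 (range c) : Set Z)) {z : ℕ → Z}
    (hz : ∀ j, ‖z j‖ ≤ 1) {δ : ℝ} (hδ : 0 < δ) :
    ∃ p : NormProblem (G ⊕ ℕ), p.Solves 𝕜 norm (Sum.elim c z) ∧
      ∀ y : ℕ → Z, (∀ j, ‖y j‖ ≤ 1) → p.Solves 𝕜 norm (Sum.elim c y) → ∀ x ∈ F,
        |‖x.1 + Finsupp.linearCombination 𝕜 y x.2‖ -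
          ‖x.1 + Finsupp.linearCombination 𝕜 z x.2‖| < δ := by
  obtain ⟨r, hr, hrδ⟩ := exists_rat_btwn (show 0 < δ / 4 by positivity)
  choose! l hl using fun x hx => exists_codedSum_sumElim_near hc (hFc x hx) x.2 hr
  choose q hq using fun x => exists_rat_near ‖codedSum 𝕜 (Sum.elim c z) (l x)‖ hr
  refine ⟨hF.toFinset.toList.map fun x => (l x, q x, r), ?_, fun y hy hp x hx => ?_⟩
  · exact List.forall_mem_map.2 fun x _ => (hq x).le
  have hqy := List.forall_mem_map.1 hp x (by simpa using hx)
  have near_z := (abs_norm_sub_norm_le _ _).trans (hl x hx z hz)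
  have near_y := (abs_norm_sub_norm_le _ _).trans (hl x hx y hy)
  have hqz := hq x
  simp only [abs_le, abs_lt] at hqy hqz near_z near_y ⊢
  constructor <;> linarith

theorem exists_linearCombination_eq {V : Type*} [AddCommGroup V] [Module 𝕜 V]
    [FiniteDimensional 𝕜 V] (f : V →ₗ[𝕜] Z) :
    ∃ z : ℕ → Z, (∀ j, ‖z j‖ ≤ 1) ∧
      ∃ d : V →ₗ[𝕜] (ℕ →₀ 𝕜), Finsupp.linearCombination 𝕜 z ∘ₗ d = f := by
  let b := Module.finBasis 𝕜 V
  let z : Fin (Module.finrank 𝕜 V) → Z := fun j => ((‖f (b j)‖⁻¹ : ℝ) : 𝕜) • f (b j)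
  have norm_z : ∀ j, ‖z j‖ ≤ 1 := fun j => by
    rw [norm_smul, RCLike.norm_ofReal, abs_inv, abs_norm]
    exact inv_mul_le_one
  refine ⟨Function.extend Fin.val z 0, fun j => ?_,
    b.constr 𝕜 fun j => Finsupp.single (j : ℕ) (‖f (b j)‖ : 𝕜), b.ext fun j => ?_⟩
  · by_cases hj : ∃ j' : Fin (Module.finrank 𝕜 V), (j' : ℕ) = j
    · obtain ⟨j', rfl⟩ := hj
      exact (congrArg norm (Fin.val_injective.extend_apply _ _ _)).trans_le (norm_z j')
    · simp [Function.extend_apply' _ _ _ hj]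
  · rw [LinearMap.comp_apply, b.constr_basis, Finsupp.linearCombination_single,
      Fin.val_injective.extend_apply, smul_smul, ← RCLike.ofReal_mul]
    rcases eq_or_ne (f (b j)) 0 with h | h
    · rw [h, smul_zero]
    · rw [mul_inv_cancel₀ (norm_ne_zero_iff.2 h), RCLike.ofReal_one, one_smul]

theorem exists_decomposition (Y A : Submodule 𝕜 Z) [FiniteDimensional 𝕜 A] :
    ∃ (π : A →ₗ[𝕜] Z) (d : A →ₗ[𝕜] (ℕ →₀ 𝕜)) (z : ℕ → Z), (∀ a, π a ∈ Y) ∧ (∀ j, ‖z j‖ ≤ 1) ∧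
      (∀ a : A, π a + Finsupp.linearCombination 𝕜 z (d a) = a) ∧
      ∀ a : A, (a : Z) ∈ Y → d a = 0 := by
  let A₀ : Submodule 𝕜 A := Y.comap A.subtype
  obtain ⟨s, hs⟩ := A₀.mkQ.exists_rightInverse_of_surjective A₀.range_mkQ
  obtain ⟨z, hz, d, hd⟩ := exists_linearCombination_eq (A.subtype ∘ₗ s)
  refine ⟨A.subtype ∘ₗ (.id - s ∘ₗ A₀.mkQ), d ∘ₗ A₀.mkQ, z, fun a => ?_, hz, fun a => ?_,
    fun a ha => ?_⟩
  · have : a - s (A₀.mkQ a) ∈ A₀ := by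
      rw [← Submodule.Quotient.eq]
      exact (LinearMap.congr_fun hs (A₀.mkQ a)).symm
    exact this
  · have : Finsupp.linearCombination 𝕜 z (d (A₀.mkQ a)) = s (A₀.mkQ a) :=
      LinearMap.congr_fun hd (A₀.mkQ a)
    rw [LinearMap.comp_apply d, this]
    exact sub_add_cancel (a : Z) _
  · have : A₀.mkQ a = 0 := (Submodule.Quotient.mk_eq_zero A₀).2 ha
    rw [LinearMap.comp_apply, this, map_zero]

theorem isReflecting_of_forall_solves {G : Type*} {Y : Submodule 𝕜 Z} {c : G → Z}
    (hc : ∀ g, ‖c g‖ ≤ 1) (hY : (Y : Set Z) ⊆ closure (Submodule.span 𝕜 (range c)))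
    (h : ∀ (p : NormProblem (G ⊕ ℕ)) (z : ℕ → Z), (∀ j, ‖z j‖ ≤ 1) →
      p.Solves 𝕜 norm (Sum.elim c z) →
        ∃ y : ℕ → Z, (∀ j, ‖y j‖ ≤ 1) ∧ (∀ j, y j ∈ Y) ∧ p.Solves 𝕜 norm (Sum.elim c y)) :
    IsReflecting 𝕜 Y := by
  refine isReflecting_of_forall_finiteDimensional fun A _ => mem_closure_pi_real_iff.2
    fun F hF δ hδ => ?_
  obtain ⟨π, d, z, hπ, hz, decomposition, hd⟩ := exists_decomposition Y A
  obtain ⟨p, hp, hpδ⟩ := exists_normProblem_forall_solution hc (hF.image fun a => (π a, d a))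
    (forall_mem_image.2 fun a _ => hY (hπ a)) hz hδ
  obtain ⟨y, hy, hyY, hpy⟩ := h p z hz hp
  refine ⟨_, ⟨π + Finsupp.linearCombination 𝕜 y ∘ₗ d, ⟨fun a => ?_, fun a ha => ?_⟩, rfl⟩,
    fun a ha => ?_⟩
  · exact Y.add_mem (hπ a) (Y.sum_mem fun j _ => Y.smul_mem _ (hyY j))
  · have π_eq := decomposition a
    rw [hd a ha, map_zero, add_zero] at π_eq
    rw [LinearMap.add_apply, LinearMap.comp_apply, hd a ha, map_zero, add_zero, π_eq]
  · have := hpδ y hy hpy _ (mem_image_of_mem _ ha)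
    rwa [decomposition a] at this

end Reflecting

section Dimension

theorem exists_denseRange_of_isometry {α β γ : Type*} [PseudoMetricSpace α] [PseudoMetricSpace β]
    [Nonempty α] {j : α → β} (hj : Isometry j) {g : γ → β} (hg : DenseRange g) :
    ∃ f : γ × ℕ → α, DenseRange f := by
  let f : γ × ℕ → α := fun x => Classical.epsilon fun a => dist (j a) (g x.1) < 1 / (x.2 + 1 : ℝ)
  refine ⟨f, Metric.denseRange_iff.2 fun a r hr => ?_⟩
  obtain ⟨n, hn⟩ := exists_nat_one_div_lt (half_pos hr)
  obtain ⟨c, hc⟩ := hg.exists_dist_lt (j a) (Nat.one_div_pos_of_nat (α := ℝ) (n := n))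
  have hf : dist (j (f (c, n))) (g c) < 1 / (n + 1 : ℝ) :=
    Classical.epsilon_spec (p := fun a => dist (j a) (g c) < 1 / (n + 1 : ℝ)) ⟨a, hc⟩
  refine ⟨(c, n), ?_⟩
  rw [← hj.dist_eq]
  linarith [dist_triangle_right (j a) (j (f (c, n))) (g c)]

variable {𝕜 : Type v} [RCLike 𝕜] {E : Type u} [NormedAddCommGroup E] [NormedSpace 𝕜 E]

theorem denseRange_codedSum {I : Type*} {c : I → E} (hc : ∀ i, ‖c i‖ ≤ 1)
    (hspan : Dense (Submodule.span 𝕜 (range c) : Set E)) : DenseRange (codedSum 𝕜 c) := by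
  refine Metric.denseRange_iff.2 fun x r hr => ?_
  obtain ⟨_, he, hxe⟩ := hspan.exists_dist_lt x (half_pos hr)
  obtain ⟨w, rfl⟩ := Finsupp.mem_span_range_iff_exists_finsupp.1 he
  obtain ⟨l, hl⟩ := exists_codedSum_near (Z := E) w (half_pos hr)
  refine ⟨l, (dist_triangle _ _ _).trans_lt ((add_lt_add_of_lt_of_le hxe ?_).trans_eq
    (add_halves r))⟩
  rw [dist_eq_norm]
  exact hl c hc

theorem small_of_not_finiteDimensional (hE : ¬ FiniteDimensional 𝕜 E) : Small.{u} 𝕜 := by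
  have : Nontrivial E := not_subsingleton_iff_nontrivial.1 fun _ => hE inferInstance
  obtain ⟨x, hx⟩ := exists_ne (0 : E)
  exact small_of_injective (smul_left_injective 𝕜 hx)

theorem infinite_of_dense_span (hE : ¬ FiniteDimensional 𝕜 E) {S : Set E}
    (hS : Dense (Submodule.span 𝕜 S : Set E)) : Infinite S := by
  refine not_finite_iff_infinite.1 fun hfin => hE ?_
  have : FiniteDimensional 𝕜 (Submodule.span 𝕜 S) :=
    FiniteDimensional.span_of_finite 𝕜 (toFinite S)
  have span_eq_top : Submodule.span 𝕜 S = ⊤ :=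
    SetLike.coe_injective ((Submodule.closed_of_finiteDimensional _).closure_eq.symm.trans
      hS.closure_eq)
  rw [span_eq_top] at this
  exact Module.finite_def.2 (Module.Finite.iff_fg.1 this)

theorem span_le_span_range_inv_norm_smul (S : Set E) :
    Submodule.span 𝕜 S ≤
      Submodule.span 𝕜 (range fun s : S => ((‖(s : E)‖⁻¹ : ℝ) : 𝕜) • (s : E)) := by
  refine Submodule.span_le.2 fun s hs => ?_
  have rescaled := Submodule.smul_mem _ (‖s‖ : 𝕜) (Submodule.subset_span (R := 𝕜)
    (mem_range_self (f := fun s : S => ((‖(s : E)‖⁻¹ : ℝ) : 𝕜) • (s : E)) ⟨s, hs⟩))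
  rcases eq_or_ne s 0 with rfl | hs₀
  · exact Submodule.zero_mem _
  · rwa [smul_smul, ← RCLike.ofReal_mul, mul_inv_cancel₀ (norm_ne_zero_iff.2 hs₀),
      RCLike.ofReal_one, one_smul] at rescaled

theorem exists_family_mk_eq_banachDim (hE : ¬ FiniteDimensional 𝕜 E) :
    ∃ I : Type u, Infinite I ∧ #I = banachDim 𝕜 E ∧
      ∃ c : I → E, (∀ i, ‖c i‖ ≤ 1) ∧ Dense (Submodule.span 𝕜 (range c) : Set E) := by
  obtain ⟨S, hScard, hS⟩ := csInf_mem (s := {c : Cardinal.{u} | ∃ S : Set E, #S = c ∧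
    Dense (Submodule.span 𝕜 S : Set E)}) ⟨_, univ, rfl, by simp⟩
  refine ⟨S, infinite_of_dense_span hE hS, hScard, _, fun s => ?_,
    hS.mono (span_le_span_range_inv_norm_smul S)⟩
  rw [norm_smul, RCLike.norm_ofReal, abs_inv, abs_norm]
  exact inv_mul_le_one

theorem banachDim_le_mk {I : Type u} {c : I → E}
    (hc : Dense (Submodule.span 𝕜 (range c) : Set E)) : banachDim 𝕜 E ≤ #I := by
  have : banachDim 𝕜 E ≤ #(range c) := csInf_le' ⟨range c, rfl, hc⟩
  exact this.trans mk_range_le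

theorem banachDim_le_of_isometry {Y : Type u} [NormedAddCommGroup Y] [NormedSpace 𝕜 Y]
    (hY : ¬ FiniteDimensional 𝕜 Y) (j : Y →ₗᵢ[𝕜] E) : banachDim 𝕜 Y ≤ banachDim 𝕜 E := by
  have hE : ¬ FiniteDimensional 𝕜 E := fun _ =>
    hY (FiniteDimensional.of_injective j.toLinearMap j.injective)
  obtain ⟨I, _, hI, c, hc, hspan⟩ := exists_family_mk_eq_banachDim hE
  obtain ⟨f, hf⟩ := exists_denseRange_of_isometry j.isometry (denseRange_codedSum hc hspan)
  calc banachDim 𝕜 Y ≤ #(List (I × ℕ) × ℕ) := banachDim_le_mk (hf.mono Submodule.subset_span)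
    _ = #I := by simp [Cardinal.mk_list_eq_mk]
    _ = banachDim 𝕜 E := hI

end Dimension

section Extension

variable {𝕜 : Type v} [RCLike 𝕜]

theorem exists_denseRange_norm_eq {W : Type u} [AddCommGroup W] [Module 𝕜 W] (p : Seminorm 𝕜 W) :
    ∃ (E : Type u) (_ : NormedAddCommGroup E) (_ : NormedSpace 𝕜 E) (_ : CompleteSpace E)
      (φ : W →ₗ[𝕜] E), DenseRange φ ∧ ∀ w, ‖φ w‖ = p w := by
  let : Norm W := ⟨p⟩
  have core : SeminormedSpace.Core 𝕜 W :=
    ⟨fun w => apply_nonneg p w, fun c w => map_smul_eq_mul p c w, fun x y => map_add_le_add p x y⟩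
  let : SeminormedAddCommGroup W := SeminormedAddCommGroup.ofCore core
  let : NormedSpace 𝕜 W := { norm_smul_le := fun c w => (map_smul_eq_mul p c w).le }
  exact ⟨UniformSpace.Completion W, inferInstance, inferInstance, inferInstance,
    (UniformSpace.Completion.toComplₗᵢ (𝕜 := 𝕜) (E := W)).toLinearMap,
    UniformSpace.Completion.denseRange_coe, fun w => UniformSpace.Completion.norm_coe w⟩

theorem nonempty_linearIsometry_of_norm_eq {V Y E : Type*} [AddCommGroup V] [Module 𝕜 V]
    [NormedAddCommGroup Y] [NormedSpace 𝕜 Y] [NormedAddCommGroup E] [NormedSpace 𝕜 E]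
    [CompleteSpace E] {T : V →ₗ[𝕜] Y} (hT : DenseRange T) (S : V →ₗ[𝕜] E)
    (h : ∀ x, ‖S x‖ = ‖T x‖) : Nonempty (Y →ₗᵢ[𝕜] E) := by
  let J : Y →L[𝕜] E := S.extendOfNorm T
  have J_comp : ∀ x, J (T x) = S x :=
    LinearMap.extendOfNorm_eq hT ⟨1, fun x => by rw [one_mul, h]⟩
  exact ⟨⟨J, fun y => hT.induction_on (p := fun y => ‖J y‖ = ‖y‖) y
    (isClosed_eq (by fun_prop) (by fun_prop)) fun x => by rw [J_comp, h]⟩⟩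

theorem exists_module_basis (𝕜 : Type v) [RCLike 𝕜] [Small.{u} 𝕜] (G : Type u) :
    ∃ (W : Type u) (_ : AddCommGroup W) (_ : Module 𝕜 W), Nonempty (Module.Basis G 𝕜 W) := by
  have : Small.{u} (G →₀ 𝕜) := small_of_injective (DFunLike.coe_injective (F := G →₀ 𝕜))
  exact ⟨Shrink.{u} (G →₀ 𝕜), inferInstance, inferInstance, ⟨.ofRepr (Shrink.linearEquiv 𝕜 _)⟩⟩

theorem dense_span_range_comp_basis {G W E : Type*} [AddCommGroup W] [Module 𝕜 W]
    [NormedAddCommGroup E] [NormedSpace 𝕜 E] (b : Module.Basis G 𝕜 W) {φ : W →ₗ[𝕜] E}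
    (hφ : DenseRange φ) : Dense (Submodule.span 𝕜 (range (φ ∘ b)) : Set E) := by
  rw [range_comp, ← Submodule.map_span, b.span_eq, Submodule.map_top]
  exact hφ

/-- Saturation of a family `c` in `E`, relative to `X`: every norm problem with parameters in `c`
that is solved by vectors of norm at most `1` in some extension of `E` finitely representable in
`X` is already solved by such vectors in `E`. -/
def IsSaturated (𝕜 : Type v) [RCLike 𝕜] (X : Type w) [NormedAddCommGroup X] [NormedSpace 𝕜 X]
    {G : Type*} {E : Type u} [NormedAddCommGroup E] [NormedSpace 𝕜 E] (c : G → E) : Prop :=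
  ∀ (Z : Type u) [NormedAddCommGroup Z] [NormedSpace 𝕜 Z], FinitelyRepresentable 𝕜 Z X →
    ∀ (i : E →ₗᵢ[𝕜] Z) (p : NormProblem (G ⊕ ℕ)) (z : ℕ → Z), (∀ j, ‖z j‖ ≤ 1) →
      p.Solves 𝕜 norm (Sum.elim (i ∘ c) z) →
        ∃ y : ℕ → E, (∀ j, ‖y j‖ ≤ 1) ∧ p.Solves 𝕜 norm (Sum.elim c y)

theorem IsSaturated.isExistentiallyClosed {X E : Type u} {G : Type*} [NormedAddCommGroup X]
    [NormedSpace 𝕜 X] [NormedAddCommGroup E] [NormedSpace 𝕜 E] {c : G → E} (h : IsSaturated 𝕜 X c)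
    (hc : ∀ g, ‖c g‖ ≤ 1) (hspan : Dense (Submodule.span 𝕜 (range c) : Set E))
    (hXE : FinitelyEquivalent 𝕜 X E) : IsExistentiallyClosed 𝕜 X E := by
  refine ⟨hXE, fun Z _ _ _ hXZ i => ?_⟩
  refine isReflecting_of_forall_solves (c := i ∘ c) (fun g => (i.norm_map _).trans_le (hc g)) ?_
    fun p z hz hp => ?_
  · rintro _ ⟨e, rfl⟩
    rw [range_comp, ← LinearIsometry.coe_toLinearMap, ← Submodule.map_span, Submodule.map_coe]
    exact image_closure_subset_closure_image i.continuous (mem_image_of_mem i (hspan e))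
  · obtain ⟨y, hy, hyp⟩ := h Z hXZ.2 i p z hz hp
    refine ⟨i ∘ y, fun j => (i.norm_map _).trans_le (hy j), fun j => ⟨y j, rfl⟩, ?_⟩
    exact (NormProblem.solves_iff_of_forall_mem_vars i.toLinearMap i.norm_map
      (Sum.forall.2 ⟨fun _ _ => rfl, fun _ _ => rfl⟩)).1 hyp

theorem exists_isSaturated {G X : Type*} {W : Type u} [AddCommGroup W] [Module 𝕜 W]
    [NormedAddCommGroup X] [NormedSpace 𝕜 X] (b : Module.Basis G 𝕜 W) {ρ : G → ℕ}
    {σ : NormProblem (G ⊕ ℕ) × ℕ → G} (hσ : Function.Injective σ)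
    (hρ : ∀ p j, p.rank ρ < ρ (σ (p, j))) {N₀ : W → ℝ} (hN₀ : N₀ ∈ representableSeminorms 𝕜 W X)
    (hN₀b : ∀ g, N₀ (b g) ≤ 1) :
    ∃ (E : Type u) (_ : NormedAddCommGroup E) (_ : NormedSpace 𝕜 E) (_ : CompleteSpace E)
      (φ : W →ₗ[𝕜] E), DenseRange φ ∧ FinitelyRepresentable 𝕜 E X ∧ (∀ g, ‖φ (b g)‖ ≤ 1) ∧
        (∀ w ∈ Submodule.span 𝕜 (b '' {g | ρ g = 0}), ‖φ w‖ = N₀ w) ∧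
        IsSaturated 𝕜 X (φ ∘ b) := by
  obtain ⟨N, hN, hNb, hNN₀, saturated⟩ := exists_saturated_seminorm b hσ hρ hN₀ hN₀b
  obtain ⟨p, rfl⟩ := exists_seminorm_coe_eq hN
  obtain ⟨E, _, _, _, φ, hφ, norm_φ⟩ := exists_denseRange_norm_eq p
  refine ⟨E, inferInstance, inferInstance, inferInstance, φ, hφ,
    finitelyRepresentable_of_denseRange hφ (by simpa only [norm_φ] using hN),
    fun g => (norm_φ _).trans_le (hNb g), fun w hw => (norm_φ w).trans (hNN₀ w hw),
    fun Z _ _ hZ i q z hz hq => ⟨fun j => φ (b (σ (q, j))),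
      fun j => (norm_φ _).trans_le (hNb _), ?_⟩⟩
  have solved := saturated Z hZ (i.toLinearMap ∘ₗ φ) (fun w => (i.norm_map _).trans (norm_φ w))
    q z hz hq
  exact (NormProblem.solves_iff_of_forall_mem_vars φ norm_φ
    (Sum.forall.2 ⟨fun _ _ => rfl, fun _ _ => rfl⟩)).1 solved

theorem exists_isSaturated_extension [Small.{u} 𝕜] {X : Type*} {Y I : Type u} [Infinite I]
    [NormedAddCommGroup X] [NormedSpace 𝕜 X] [NormedAddCommGroup Y] [NormedSpace 𝕜 Y]
    (hYX : FinitelyRepresentable 𝕜 Y X) {y : I → Y} (hy : ∀ i, ‖y i‖ ≤ 1)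
    (hspan : Dense (Submodule.span 𝕜 (range y) : Set Y)) :
    ∃ (E : Type u) (_ : NormedAddCommGroup E) (_ : NormedSpace 𝕜 E) (_ : CompleteSpace E)
      (c : I × ℕ → E), (∀ g, ‖c g‖ ≤ 1) ∧ Dense (Submodule.span 𝕜 (range c) : Set E) ∧
        IsSaturated 𝕜 X c ∧ FinitelyRepresentable 𝕜 E X ∧ Nonempty (Y →ₗᵢ[𝕜] E) := by
  obtain ⟨W, _, _, ⟨b⟩⟩ := exists_module_basis 𝕜 (I × ℕ)
  obtain ⟨σ, hσ, hρ⟩ := NormProblem.exists_witness_indexing I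
  let T : W →ₗ[𝕜] Y := b.constr 𝕜 fun g => if g.2 = 0 then y g.1 else 0
  have T_basis : ∀ g, T (b g) = if g.2 = 0 then y g.1 else 0 := b.constr_basis 𝕜 _
  have norm_T_le : ∀ g, ‖T (b g)‖ ≤ 1 := fun g => by
    rw [T_basis]
    split_ifs
    exacts [hy _, norm_zero.trans_le zero_le_one]
  obtain ⟨E, _, _, _, φ, hφ, hE, norm_φ_le, norm_φ, saturated⟩ := exists_isSaturated b hσ hρ
    (hYX.representableSeminorms_subset (norm_comp_mem_representableSeminorms T)) norm_T_le
  refine ⟨E, inferInstance, inferInstance, inferInstance, φ ∘ b, norm_φ_le,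
    dense_span_range_comp_basis b hφ, saturated, hE, ?_⟩
  let V : Submodule 𝕜 W := Submodule.span 𝕜 (b '' {g | g.2 = 0})
  have dense_T : DenseRange (T ∘ₗ V.subtype) := by
    refine hspan.mono ?_
    rw [← LinearMap.coe_range]
    refine Submodule.span_le.2 (range_subset_iff.2 fun i => ?_)
    exact ⟨⟨b (i, 0), Submodule.subset_span (mem_image_of_mem b rfl)⟩, T_basis (i, 0)⟩
  exact nonempty_linearIsometry_of_norm_eq dense_T (φ ∘ₗ V.subtype) fun x => norm_φ x x.2

end Extension

theorem theorem2_general {𝕜 : Type v} [RCLike 𝕜] {X Y : Type u} [NormedAddCommGroup X]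
    [NormedSpace 𝕜 X] [NormedAddCommGroup Y] [NormedSpace 𝕜 Y] (hX : ¬ FiniteDimensional 𝕜 X)
    (hXY : FinitelyEquivalent 𝕜 X Y) :
    ∃ (E : Type u) (_ : NormedAddCommGroup E) (_ : NormedSpace 𝕜 E) (_ : CompleteSpace E),
      IsExistentiallyClosed 𝕜 X E ∧ Nonempty (Y →ₗᵢ[𝕜] E) ∧ banachDim 𝕜 E = banachDim 𝕜 Y := by
  have hY := hXY.1.not_finiteDimensional hX
  have := small_of_not_finiteDimensional hY
  obtain ⟨I, _, hI, y, hy, dense_y⟩ := exists_family_mk_eq_banachDim hY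
  obtain ⟨E, _, _, _, c, hc, dense_c, saturated, hEX, ⟨j⟩⟩ :=
    exists_isSaturated_extension hXY.2 hy dense_y
  have hXE : FinitelyEquivalent 𝕜 X E := ⟨hXY.1.trans (.of_isometry j), hEX⟩
  refine ⟨E, inferInstance, inferInstance, inferInstance,
    saturated.isExistentiallyClosed hc dense_c hXE, ⟨j⟩, le_antisymm ?_
      (banachDim_le_of_isometry hY j)⟩
  calc banachDim 𝕜 E ≤ #(I × ℕ) := banachDim_le_mk dense_c
    _ = #I := by simp
    _ = banachDim 𝕜 Y := hI

theorem theorem2 {𝕜 : Type v} [RCLike 𝕜] (X : Type u) [NormedAddCommGroup X] [NormedSpace 𝕜 X]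
    [CompleteSpace X] (hX : ¬ FiniteDimensional 𝕜 X) :
    (∃ (E : Type u) (_ : NormedAddCommGroup E) (_ : NormedSpace 𝕜 E) (_ : CompleteSpace E),
      IsExistentiallyClosed 𝕜 X E) ∧
    ∀ (Y : Type u) [NormedAddCommGroup Y] [NormedSpace 𝕜 Y] [CompleteSpace Y],
      FinitelyEquivalent 𝕜 X Y →
        ∃ (E : Type u) (_ : NormedAddCommGroup E) (_ : NormedSpace 𝕜 E) (_ : CompleteSpace E),
          IsExistentiallyClosed 𝕜 X E ∧ Nonempty (Y →ₗᵢ[𝕜] E) ∧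
            banachDim 𝕜 E = banachDim 𝕜 Y := by
  obtain ⟨E, h₁, h₂, h₃, hE, -⟩ := theorem2_general hX (FinitelyEquivalent.refl X)
  exact ⟨⟨E, h₁, h₂, h₃, hE⟩, fun Y _ _ _ hXY => theorem2_general hX hXY⟩
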